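/- All representations are over $\mathbb{C}$. Let $G$ be a finite group and let $D(G)$ be its Drinfel'd double, i.e. the Hopf algebra with basis $e_g\# x$ ($g,x\in G$), product $(e_g\# x)(e_h\# y)=\delta_{g,xhx^{-1}}\,e_g\# xy$, coproduct $\Delta(e_g\# x)=\sum_{ab=g}(e_a\# x)\otimes(e_b\# x)$ and counit $\varepsilon(e_g\# x)=\delta_{g,1}$. Let $\Lambda$ be its normalized integral (the unique two-sided integral with $\varepsilon(\Lambda)=1$). For $h\in D(G)$ and a positive integer $n$ write $h^{[n]}=h_1h_2\cdots h_n$ in Sweedler notation. The $n$-th Frobenius--Schur indicator of an irreducible representation $V$ of $D(G)$ with character $\chi$ is $\nu_n(V)=\chi(\Lambda^{[n]})$. The group $G$ is called FSZ if $\nu_n(V)\in\mathbb{Z}$ for every positive integer $n$ and every irreducible representation $V$ of $D(G)$. A $p$-group $P$ is called regular (P. Hall) if for all $a,b\in P$ and every power $n=p^{\alpha}$ ($\alpha\ge 0$) there are elements $s_1,\dots,s_t$ of the commutator subgroup of $\langle a,b\rangle$ with $(ab)^n=a^nb^ns_1^n\cdots s_t^n$. A finite group $G$ is called a regular CN-group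 if the centralizer in $G$ of every nonidentity element is a direct product of finitely many regular $p$-groups (where the prime $p$ may depend on the factor), and a regular nilpotent group if it is nilpotent and all of its Sylow subgroups are regular. Then every regular CN-group is FSZ, and every regular nilpotent group is FSZ. -/

import Mathlib

open scoped TensorProduct

universe u v

noncomputable section

/-! # Frobenius–Schur indicators of Hopf algebras over the complex numbers -/

section Indicators

variable (H : Type u) [Ring H] [HopfAlgebra ℂ H]

/-- The Sweedler power `h ↦ h^{[n]} = h₁ h₂ ⋯ hₙ`, as a linear endomorphism of `H`
(with `h^{[0]} = ε(h) 1` and `h^{[n+1]} = (h₁)^{[n]} h₂`). -/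
def sweedlerPow : ℕ → (H →ₗ[ℂ] H)
  | 0 => Algebra.linearMap ℂ H ∘ₗ Coalgebra.counit
  | n + 1 => LinearMap.mul' ℂ H ∘ₗ (sweedlerPow n).rTensor H ∘ₗ Coalgebra.comul

variable {H}

/-- `Λ` is a normalized (two-sided) integral of `H`. -/
structure IsNormalizedIntegral (Λ : H) : Prop where
  mul_left : ∀ h : H, h * Λ = (Coalgebra.counit h : ℂ) • Λ
  mul_right : ∀ h : H, Λ * h = (Coalgebra.counit h : ℂ) • Λ
  counit_eq_one : (Coalgebra.counit Λ : ℂ) = 1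

/-- A normalized integral is unique. -/
theorem IsNormalizedIntegral.unique {Λ M : H} (hΛ : IsNormalizedIntegral Λ)
    (hM : IsNormalizedIntegral M) : Λ = M := by
  have h1 := hM.mul_left Λ
  have h2 := hΛ.mul_right M
  rw [hΛ.counit_eq_one, one_smul] at h1
  rw [hM.counit_eq_one, one_smul] at h2
  exact h2.symm.trans h1

/-- The character of an `H`-module `V` over the complex numbers: `h` is sent to the trace of the
action of `h` on `V`. -/
def moduleCharacter (V : Type v) [AddCommGroup V] [Module ℂ V] [Module H V]
    [IsScalarTower ℂ H V] (h : H) : ℂ :=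
  LinearMap.trace ℂ V (Algebra.lsmul ℂ ℂ V h)

/-- The `n`-th Frobenius–Schur indicator `χ(Λ^{[n]})` of an `H`-module `V`, where `χ` is the
character of `V` and `Λ` is the normalized integral of `H`. -/
def frobeniusSchurIndicator (Λ : H) (n : ℕ) (V : Type v) [AddCommGroup V] [Module ℂ V]
    [Module H V] [IsScalarTower ℂ H V] : ℂ :=
  moduleCharacter V (sweedlerPow H n Λ)

end Indicators

/-! # The Drinfel'd double of a finite group -/

/-- The underlying space of the Drinfel'd double `D(G) = ℂ^G ⋊ ℂG` of a finite group `G`.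
The element `f` stands for `∑ g x, f.coeff g x • (e_g # x)`, where `e_g` is the indicator function
of `g`. -/
@[ext]
structure DrinfeldDouble (G : Type u) : Type u where
  /-- The coefficient of `e_g # x`. -/
  coeff : G → G → ℂ

namespace DrinfeldDouble

section Linear

variable {G : Type u}

/-- The coefficient function determines the element. -/
def coeffEquiv : DrinfeldDouble G ≃ (G → G → ℂ) where
  toFun := coeff
  invFun := mk
  left_inv _ := rfl
  right_inv _ := rfl

instance : AddCommGroup (DrinfeldDouble G) := coeffEquiv.addCommGroup
instance : Module ℂ (DrinfeldDouble G) := coeffEquiv.module ℂ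

open Classical in
/-- The basis element `e_g # x` of `D(G)`. -/
def basisElt (g x : G) : DrinfeldDouble G := ⟨fun h y => if h = g ∧ y = x then 1 else 0⟩

open Classical in
theorem coeff_basisElt (g x h y : G) :
    (basisElt g x).coeff h y = if h = g ∧ y = x then 1 else 0 := rfl

theorem ext_coeff {f f' : DrinfeldDouble G} (h : ∀ g x, f.coeff g x = f'.coeff g x) : f = f' :=
  DrinfeldDouble.ext (funext fun g => funext fun x => h g x)

theorem coeff_add (f f' : DrinfeldDouble G) (g x : G) :
    (f + f').coeff g x = f.coeff g x + f'.coeff g x := rfl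

theorem coeff_zero (g x : G) : (0 : DrinfeldDouble G).coeff g x = 0 := rfl

theorem coeff_smul (c : ℂ) (f : DrinfeldDouble G) (g x : G) :
    (c • f).coeff g x = c * f.coeff g x := rfl

/-- The coefficient of `e_g # x`, as a linear map. -/
def coeffLin (g x : G) : DrinfeldDouble G →ₗ[ℂ] ℂ where
  toFun f := f.coeff g x
  map_add' _ _ := rfl
  map_smul' _ _ := rfl

theorem coeffLin_apply (g x : G) (f : DrinfeldDouble G) : coeffLin g x f = f.coeff g x := rfl

theorem coeff_sum {ι : Type*} (s : Finset ι) (F : ι → DrinfeldDouble G) (g x : G) :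
    (∑ i ∈ s, F i).coeff g x = ∑ i ∈ s, (F i).coeff g x :=
  map_sum (coeffLin g x) F s

end Linear

variable {G : Type u}
section Unit

variable [Group G]

open Classical in
/-- The unit `∑ g, e_g # 1` of `D(G)`. -/
instance : One (DrinfeldDouble G) where
  one := ⟨fun _ x => if x = 1 then 1 else 0⟩

open Classical in
theorem coeff_one (g x : G) : (1 : DrinfeldDouble G).coeff g x = if x = 1 then 1 else 0 := rfl

end Unit

variable [Fintype G]

theorem eq_sum (f : DrinfeldDouble G) : f = ∑ g, ∑ x, f.coeff g x • basisElt g x := by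
  classical
  refine ext_coeff fun h y => ?_
  simp only [coeff_sum, coeff_smul, basisElt]
  rw [Finset.sum_eq_single h, Finset.sum_eq_single y]
  · simp
  · intro b _ hb; simp [hb.symm]
  · simp
  · intro b _ hb; simp [hb.symm]
  · simp

theorem linearMap_ext {M : Type*} [AddCommGroup M] [Module ℂ M]
    {φ ψ : DrinfeldDouble G →ₗ[ℂ] M} (h : ∀ g x, φ (basisElt g x) = ψ (basisElt g x)) :
    φ = ψ := by
  refine LinearMap.ext fun f => ?_
  rw [eq_sum f]
  simp only [map_sum, map_smul, h]

variable [Group G]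

/-- Multiplication of `D(G)`: on the basis it is
`(e_g # x) (e_h # y) = δ_{g, x h x⁻¹} (e_g # x y)`, see `basisElt_mul_basisElt`. -/
instance : Mul (DrinfeldDouble G) where
  mul f f' := ⟨fun g z => ∑ x, f.coeff g x * f'.coeff (x⁻¹ * g * x) (x⁻¹ * z)⟩

theorem coeff_mul (f f' : DrinfeldDouble G) (g z : G) :
    (f * f').coeff g z = ∑ x, f.coeff g x * f'.coeff (x⁻¹ * g * x) (x⁻¹ * z) := rfl

instance : Ring (DrinfeldDouble G) where
  __ := (inferInstance : AddCommGroup (DrinfeldDouble G))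
  mul_assoc f f' f'' := ext_coeff fun g z => by
    simp only [coeff_mul, Finset.sum_mul, Finset.mul_sum]
    rw [Finset.sum_comm]
    refine Finset.sum_congr rfl fun x _ => ?_
    rw [← Equiv.sum_comp (Equiv.mulLeft x)]
    refine Finset.sum_congr rfl fun w _ => ?_
    simp [mul_assoc]
  one_mul f := ext_coeff fun g z => by
    classical
    simp [coeff_mul, coeff_one]
  mul_one f := ext_coeff fun g z => by
    rw [coeff_mul, Finset.sum_eq_single z]
    · simp [coeff_one]
    · intro b _ hb; simp [coeff_one, inv_mul_eq_one, hb]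
    · simp
  left_distrib f f' f'' := ext_coeff fun g z => by
    simp [coeff_mul, coeff_add, mul_add, Finset.sum_add_distrib]
  right_distrib f f' f'' := ext_coeff fun g z => by
    simp [coeff_mul, coeff_add, add_mul, Finset.sum_add_distrib]
  zero_mul f := ext_coeff fun g z => by simp [coeff_mul, coeff_zero]
  mul_zero f := ext_coeff fun g z => by simp [coeff_mul, coeff_zero]

instance : Algebra ℂ (DrinfeldDouble G) :=
  Algebra.ofModule
    (fun c f f' => ext_coeff fun g z => by
      simp [coeff_mul, coeff_smul, Finset.mul_sum, mul_assoc])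
    (fun c f f' => ext_coeff fun g z => by
      simp [coeff_mul, coeff_smul, Finset.mul_sum, mul_left_comm])

open Classical in
theorem basisElt_mul_basisElt (g x h y : G) :
    basisElt g x * basisElt h y = if g = x * h * x⁻¹ then basisElt g (x * y) else 0 := by
  refine ext_coeff fun k z => ?_
  rw [coeff_mul, Finset.sum_eq_single x]
  · simp only [coeff_basisElt]
    by_cases hk : k = g
    · subst hk
      have e1 : (x⁻¹ * k * x = h) ↔ (k = x * h * x⁻¹) := by
        constructor
        · rintro rfl; group
        · intro e; rw [e]; group
      by_cases hh : k = x * h * x⁻¹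
      · simp only [e1, inv_mul_eq_iff_eq_mul]
        rw [if_pos hh]
        simp [coeff_basisElt, hh]
      · simp only [e1]
        rw [if_neg hh]
        simp [coeff_zero, hh]
    · split_ifs <;> simp_all [coeff_basisElt, coeff_zero]
  · intro b _ hb; simp [coeff_basisElt, hb]
  · simp

theorem one_eq_sum : (1 : DrinfeldDouble G) = ∑ g, basisElt g 1 := by
  classical
  refine ext_coeff fun g x => ?_
  simp only [coeff_sum, coeff_basisElt, coeff_one]
  by_cases hx : x = 1 <;> simp [hx]

/-- Comultiplication of `D(G)`: `Δ(e_g # x) = ∑_{a b = g} (e_a # x) ⊗ (e_b # x)`. -/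
def comulLin : DrinfeldDouble G →ₗ[ℂ] DrinfeldDouble G ⊗[ℂ] DrinfeldDouble G :=
  ∑ g, ∑ x, (coeffLin g x).smulRight (∑ a, basisElt a x ⊗ₜ[ℂ] basisElt (a⁻¹ * g) x)

/-- Counit of `D(G)`: `ε(e_g # x) = δ_{g, 1}`. -/
def counitLin : DrinfeldDouble G →ₗ[ℂ] ℂ := ∑ x, coeffLin 1 x

/-- Antipode of `D(G)`: `S(e_g # x) = e_{x⁻¹ g⁻¹ x} # x⁻¹`, see `antipodeLin_basisElt`. -/
def antipodeLin : DrinfeldDouble G →ₗ[ℂ] DrinfeldDouble G where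
  toFun f := ⟨fun g x => f.coeff (x⁻¹ * g⁻¹ * x) x⁻¹⟩
  map_add' _ _ := rfl
  map_smul' _ _ := rfl

theorem comulLin_basisElt (g x : G) :
    comulLin (basisElt g x) = ∑ a, basisElt a x ⊗ₜ[ℂ] basisElt (a⁻¹ * g) x := by
  classical
  simp only [comulLin, LinearMap.sum_apply, LinearMap.smulRight_apply]
  rw [Finset.sum_eq_single g, Finset.sum_eq_single x]
  · simp [coeffLin_apply, coeff_basisElt]
  · intro b _ hb; simp [coeffLin_apply, coeff_basisElt, hb]
  · simp
  · intro b _ hb; simp [coeffLin_apply, coeff_basisElt, hb]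
  · simp

open Classical in
theorem counitLin_basisElt (g x : G) :
    counitLin (basisElt g x) = if g = 1 then 1 else 0 := by
  simp only [counitLin, LinearMap.sum_apply]
  by_cases hg : g = 1
  · simp [coeffLin_apply, coeff_basisElt, hg]
  · simp [coeffLin_apply, coeff_basisElt, hg, Ne.symm hg]

theorem antipodeLin_basisElt (g x : G) :
    antipodeLin (basisElt g x) = basisElt (x⁻¹ * g⁻¹ * x) x⁻¹ := by
  classical
  refine ext_coeff fun h y => ?_
  change (basisElt g x).coeff (y⁻¹ * h⁻¹ * y) y⁻¹ = _
  simp only [coeff_basisElt]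
  have : (y⁻¹ * h⁻¹ * y = g ∧ y⁻¹ = x) ↔ (h = x⁻¹ * g⁻¹ * x ∧ y = x⁻¹) := by
    constructor
    · rintro ⟨rfl, rfl⟩; constructor <;> group
    · rintro ⟨rfl, rfl⟩; constructor <;> group
  simp only [this]

instance : Coalgebra ℂ (DrinfeldDouble G) where
  comul := comulLin
  counit := counitLin
  coassoc := linearMap_ext fun g x => by
    simp only [LinearMap.comp_apply, comulLin_basisElt, map_sum, LinearMap.rTensor_tmul,
      LinearMap.lTensor_tmul, TensorProduct.sum_tmul, TensorProduct.tmul_sum,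
      LinearEquiv.coe_coe, TensorProduct.assoc_tmul]
    rw [Finset.sum_comm]
    refine Finset.sum_congr rfl fun a _ => ?_
    rw [← Equiv.sum_comp (Equiv.mulLeft a)]
    refine Finset.sum_congr rfl fun b _ => ?_
    simp [mul_assoc]
  rTensor_counit_comp_comul := linearMap_ext fun g x => by
    classical
    simp only [LinearMap.comp_apply, comulLin_basisElt, map_sum, LinearMap.rTensor_tmul,
      counitLin_basisElt, TensorProduct.mk_apply]
    rw [Finset.sum_eq_single 1]
    · simp
    · intro b _ hb; simp [hb]
    · simp
  lTensor_counit_comp_comul := linearMap_ext fun g x => by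
    classical
    simp only [LinearMap.comp_apply, comulLin_basisElt, map_sum, LinearMap.lTensor_tmul,
      counitLin_basisElt, LinearMap.flip_apply, TensorProduct.mk_apply]
    rw [Finset.sum_eq_single g]
    · simp
    · intro b _ hb
      rw [if_neg (by simpa [inv_mul_eq_one] using hb)]; simp
    · simp

theorem comul_basisElt (g x : G) : Coalgebra.comul (R := ℂ) (basisElt g x) =
    ∑ a, basisElt a x ⊗ₜ[ℂ] basisElt (a⁻¹ * g) x := comulLin_basisElt g x

open Classical in
theorem counit_basisElt (g x : G) :
    Coalgebra.counit (R := ℂ) (basisElt g x) = if g = 1 then 1 else 0 := counitLin_basisElt g x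

theorem bilin_ext {M : Type*} [AddCommGroup M] [Module ℂ M]
    {φ ψ : DrinfeldDouble G →ₗ[ℂ] DrinfeldDouble G →ₗ[ℂ] M}
    (h : ∀ g x k y, φ (basisElt g x) (basisElt k y) = ψ (basisElt g x) (basisElt k y)) :
    φ = ψ :=
  linearMap_ext fun g x => linearMap_ext fun k y => h g x k y

instance : Bialgebra ℂ (DrinfeldDouble G) :=
  Bialgebra.mk' ℂ (DrinfeldDouble G)
    (by
      classical
      rw [one_eq_sum]
      simp [map_sum, counit_basisElt])
    (fun {f f'} => by
      classical
      have := bilin_ext (G := G) (M := ℂ)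
        (φ := (LinearMap.mul ℂ (DrinfeldDouble G)).compr₂ (Coalgebra.counit (R := ℂ)))
        (ψ := (LinearMap.mul ℂ ℂ).compl₁₂ (Coalgebra.counit (R := ℂ)) (Coalgebra.counit (R := ℂ)))
        (fun g x k y => by
          simp only [LinearMap.compr₂_apply, LinearMap.compl₁₂_apply, LinearMap.mul_apply_apply,
            basisElt_mul_basisElt, counit_basisElt]
          by_cases hg : g = 1
          · subst hg
            by_cases hk : k = 1
            · subst hk; simp [counit_basisElt]
            · rw [if_neg]
              · simp [hk]
              · intro e; apply hk
                have : k = x⁻¹ * 1 * x := by rw [e]; group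
                simpa using this
          · split_ifs <;> simp_all [counit_basisElt])
      exact LinearMap.congr_fun (LinearMap.congr_fun this f) f')
    (by
      classical
      rw [one_eq_sum]
      simp only [map_sum, comul_basisElt, Algebra.TensorProduct.one_def, one_eq_sum,
        TensorProduct.sum_tmul, TensorProduct.tmul_sum]
      rw [Finset.sum_comm]
      conv_rhs => rw [Finset.sum_comm]
      refine Finset.sum_congr rfl fun a _ => ?_
      rw [← Equiv.sum_comp (Equiv.mulLeft a)]
      simp)
    (fun {f f'} => by
      classical
      have := bilin_ext (G := G)
        (φ := (LinearMap.mul ℂ (DrinfeldDouble G)).compr₂ (Coalgebra.comul (R := ℂ)))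
        (ψ := (LinearMap.mul ℂ (DrinfeldDouble G ⊗[ℂ] DrinfeldDouble G)).compl₁₂
          (Coalgebra.comul (R := ℂ)) (Coalgebra.comul (R := ℂ)))
        (fun g x k y => by
          simp only [LinearMap.compr₂_apply, LinearMap.compl₁₂_apply, LinearMap.mul_apply_apply,
            comul_basisElt, Finset.sum_mul, Finset.mul_sum, Algebra.TensorProduct.tmul_mul_tmul]
          have key : ∀ a b : G, (basisElt a x * basisElt b y) ⊗ₜ[ℂ]
              (basisElt (a⁻¹ * g) x * basisElt (b⁻¹ * k) y) =
              if b = x⁻¹ * a * x then (if g = x * k * x⁻¹ then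
                basisElt a (x * y) ⊗ₜ[ℂ] basisElt (a⁻¹ * g) (x * y) else 0) else 0 := by
            intro a b
            rw [basisElt_mul_basisElt, basisElt_mul_basisElt]
            by_cases hb : b = x⁻¹ * a * x
            · subst hb
              have e1 : a = x * (x⁻¹ * a * x) * x⁻¹ := by group
              have e2 : x * ((x⁻¹ * a * x)⁻¹ * k) * x⁻¹ = a⁻¹ * (x * k * x⁻¹) := by group
              rw [if_pos e1, if_pos rfl, e2]
              simp only [mul_right_inj]
              split_ifs <;> simp
            · rw [if_neg hb, if_neg, TensorProduct.zero_tmul]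
              intro e; apply hb; rw [e]; group
          rw [basisElt_mul_basisElt]
          simp only [key]
          first
          | simp only [Finset.sum_ite_eq', Finset.mem_univ, if_true]
          | (rw [Finset.sum_comm]; simp only [Finset.sum_ite_eq', Finset.mem_univ, if_true])
          split_ifs with hg
          · rw [comul_basisElt]
          · simp)
      exact LinearMap.congr_fun (LinearMap.congr_fun this f) f')

instance : HopfAlgebra ℂ (DrinfeldDouble G) where
  antipode := antipodeLin
  mul_antipode_rTensor_comul := linearMap_ext fun g x => by
    classical
    simp only [LinearMap.comp_apply, comul_basisElt, map_sum, LinearMap.rTensor_tmul,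
      LinearMap.mul'_apply, antipodeLin_basisElt, basisElt_mul_basisElt, counit_basisElt,
      Algebra.linearMap_apply]
    have e : ∀ a : G, x⁻¹ * a⁻¹ * x = x⁻¹ * (a⁻¹ * g) * x⁻¹⁻¹ ↔ g = 1 := by
      intro a
      constructor
      · intro h; simpa [mul_assoc] using h
      · rintro rfl; simp
    simp only [e]
    by_cases hg : g = 1
    · simp only [if_pos hg, map_one, one_eq_sum, inv_mul_cancel]
      let φ : G ≃ G := (Equiv.inv G).trans (MulAut.conj x⁻¹).toEquiv
      rw [← Equiv.sum_comp φ (fun a => basisElt a 1)]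
      refine Finset.sum_congr rfl fun a _ => ?_
      simp [φ]
    · simp [hg]
  mul_antipode_lTensor_comul := linearMap_ext fun g x => by
    classical
    simp only [LinearMap.comp_apply, comul_basisElt, map_sum, LinearMap.lTensor_tmul,
      LinearMap.mul'_apply, antipodeLin_basisElt, basisElt_mul_basisElt, counit_basisElt,
      Algebra.linearMap_apply]
    have e : ∀ a : G, a = x * (x⁻¹ * (a⁻¹ * g)⁻¹ * x) * x⁻¹ ↔ g = 1 := by
      intro a
      constructor
      · intro h; simpa [mul_assoc] using h
      · rintro rfl; group
    simp only [e]
    by_cases hg : g = 1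
    · simp [hg, one_eq_sum]
    · simp [hg]

variable (G) in
/-- The normalized integral `Λ = |G|⁻¹ ∑ x, e_1 # x` of `D(G)`, see `isNormalizedIntegral`. -/
def integral : DrinfeldDouble G := (Fintype.card G : ℂ)⁻¹ • ∑ x, basisElt 1 x

variable (G) in
theorem isNormalizedIntegral : IsNormalizedIntegral (integral G) where
  mul_left h := by
    classical
    have : LinearMap.mulRight ℂ (integral G) =
        (Coalgebra.counit (R := ℂ) (A := DrinfeldDouble G)).smulRight (integral G) := by
      refine linearMap_ext fun g x => ?_
      simp only [LinearMap.mulRight_apply, LinearMap.smulRight_apply, integral, mul_smul_comm,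
        Finset.mul_sum, basisElt_mul_basisElt, counit_basisElt, mul_one, mul_inv_cancel]
      by_cases hg : g = 1
      · subst hg
        simp only [if_true, one_smul]
        rw [← Equiv.sum_comp (Equiv.mulLeft x) (fun y => basisElt 1 y)]
        rfl
      · simp [hg]
    exact LinearMap.congr_fun this h
  mul_right h := by
    classical
    have : LinearMap.mulLeft ℂ (integral G) =
        (Coalgebra.counit (R := ℂ) (A := DrinfeldDouble G)).smulRight (integral G) := by
      refine linearMap_ext fun g x => ?_
      simp only [LinearMap.mulLeft_apply, LinearMap.smulRight_apply, integral, smul_mul_assoc,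
        Finset.sum_mul, basisElt_mul_basisElt, counit_basisElt]
      have e : ∀ y : G, 1 = y * g * y⁻¹ ↔ g = 1 := by
        intro y
        rw [eq_comm, conj_eq_one_iff]
      simp only [e]
      by_cases hg : g = 1
      · subst hg
        simp only [if_true, one_smul]
        rw [← Equiv.sum_comp (Equiv.mulRight x) (fun y => basisElt 1 y)]
        rfl
      · simp [hg]
    exact LinearMap.congr_fun this h
  counit_eq_one := by
    classical
    simp [integral, counit_basisElt, map_sum]

end DrinfeldDouble

/-! # FSZ-groups, regular `p`-groups and regular CN-groups -/

/-- `G` is an `FSZ_n`-group: the `n`-th Frobenius–Schur indicators of all irreducible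
representations `V` of the Drinfel'd double `D(G)` are integers. -/
def IsFSZn (n : ℕ) (G : Type u) [Group G] [Fintype G] : Prop :=
  ∀ (V : Type v) [AddCommGroup V] [Module ℂ V] [Module (DrinfeldDouble G) V]
    [IsScalarTower ℂ (DrinfeldDouble G) V] [IsSimpleModule (DrinfeldDouble G) V],
    ∃ k : ℤ, frobeniusSchurIndicator (DrinfeldDouble.integral G) n V = k

/-- `G` is an `FSZ`-group: it is an `FSZ_n`-group for all positive integers `n`. -/
def IsFSZ (G : Type u) [Group G] [Fintype G] : Prop :=
  ∀ n : ℕ, 0 < n → IsFSZn.{u, v} n G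

/-- `P` is a regular `p`-group in the sense of P. Hall: for all `a`, `b` in `P` and every power
`n` of the prime `p` there are elements `s₁, …, sₜ` of the commutator subgroup of `⟨a, b⟩` with
`(a b)^n = a^n b^n s₁^n ⋯ sₜ^n`. -/
def IsRegularPGroup (p : ℕ) (P : Type u) [Group P] : Prop :=
  p.Prime ∧ IsPGroup p P ∧
    ∀ (a b : P) (α : ℕ), ∃ S : List P,
      (∀ s ∈ S, s ∈ ⁅Subgroup.closure {a, b}, Subgroup.closure {a, b}⁆) ∧
      (a * b) ^ p ^ α = a ^ p ^ α * b ^ p ^ α * (S.map fun s => s ^ p ^ α).prod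

/-- `C` is (isomorphic to) a direct product of finitely many regular `p`-groups, where the primes
`p` may vary with the factor. -/
def IsProdOfRegularPGroups (C : Type u) [Group C] : Prop :=
  ∃ (k : ℕ) (p : Fin k → ℕ) (P : Fin k → Type u) (_ : ∀ i, Group (P i)),
    (∀ i, IsRegularPGroup (p i) (P i)) ∧ Nonempty (C ≃* (∀ i, P i))

/-- `G` is a regular CN-group: the centralizer of every nonidentity element is a direct product
of regular `p`-groups. -/
def IsRegularCNGroup (G : Type u) [Group G] : Prop :=
  ∀ g : G, g ≠ 1 → IsProdOfRegularPGroups (Subgroup.centralizer {g})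

/-- `G` is a regular nilpotent group: it is nilpotent and all of its Sylow subgroups are
regular. -/
def IsRegularNilpotent (G : Type u) [Group G] : Prop :=
  Group.IsNilpotent G ∧ ∀ p : ℕ, p.Prime → ∀ P : Sylow p G, IsRegularPGroup p P

end

/-! Write `c(u, g)` for the number of `y` with `y ^ n = g = (u * y) ^ n`. Evaluating `Λ^[n]` on
basis elements gives `|G| ν_n(V) = ∑ c(a, g) χ(e_a # g⁻¹)`, summed over all `a`, `g`, and only
commuting pairs contribute. For a subgroup `K` of the centralizer of `a`, the sum of `χ(e_a # h⁻¹)`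
over `h ∈ K` is `|K|` times the trace of an idempotent, hence an integer. If `c(a, g)` depends only
on the cyclic subgroup `⟨g⟩`, the whole sum is an integer combination of such sums, so `ν_n(V)` is
rational.

It is also an algebraic integer: it is the trace of `E * C` on `V^{⊗n}`, where `C` is the cyclic
shift and `E`, the action of the integral, is an idempotent commuting with `C`. The eigenvalues of
`E * C` are therefore `0` or roots of unity. A rational algebraic integer is an integer
(`frobeniusSchurIndicator_mem_int`).

It remains to see that `c` depends only on `⟨g⟩`. By Hall, in a finite regular `p`-group `a ^ n = b
^ n` iff `(a⁻¹ * b) ^ n = 1`, and this passes to direct products. There `c(u, g)` is zero unless `u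
^ n = 1`, and is then the number of `n`-th roots of `g`, which is `0` or the number of solutions of
`y ^ n = 1`. In a regular CN-group all roots of `g ≠ 1` lie in its centralizer, so the count takes
place in such a product. -/

noncomputable section

open scoped commutatorElement

/-! ### Powers in regular `p`-groups (P. Hall) -/

/-- Raising to the `n`-th power identifies exactly those elements of `P` that differ by an element
of order dividing `n`. -/
def PowEqIffQuotientTorsion (n : ℕ) (P : Type*) [Group P] : Prop :=
  ∀ a b : P, a ^ n = b ^ n ↔ (a⁻¹ * b) ^ n = 1

/-- The `n`-th power is multiplicative on `a, b` as soon as the derived subgroup of `⟨a, b⟩` has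
exponent dividing `n`. -/
def WeaklyRegular (n : ℕ) (P : Type*) [Group P] : Prop :=
  ∀ a b : P, (∀ s ∈ ⁅Subgroup.closure {a, b}, Subgroup.closure {a, b}⁆, s ^ n = 1) →
    (a * b) ^ n = a ^ n * b ^ n

/-- The only use made of Hall's identity: all correction factors `sᵢ ^ n` vanish. -/
theorem IsRegularPGroup.weaklyRegular {p : ℕ} {P : Type u} [Group P] (h : IsRegularPGroup p P)
    (α : ℕ) : WeaklyRegular (p ^ α) P := by
  intro a b hs
  obtain ⟨S, hS, e⟩ := h.2.2 a b α
  have : (S.map fun s => s ^ p ^ α).prod = 1 := by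
    apply List.prod_eq_one
    intro x hx
    obtain ⟨s, hsS, rfl⟩ := List.mem_map.1 hx
    exact hs s (hS s hsS)
  rw [e, this, mul_one]

theorem WeaklyRegular.subgroup {n : ℕ} {P : Type*} [Group P] (h : WeaklyRegular n P)
    (K : Subgroup P) : WeaklyRegular n K := by
  intro a b hs
  apply Subtype.ext
  have := h a b ?_
  · simpa using this
  · intro s hsm
    have e : Subgroup.closure {(a : P), (b : P)} = (Subgroup.closure {a, b}).map K.subtype := by
      rw [MonoidHom.map_closure, Set.image_pair]; rfl
    rw [e, ← Subgroup.map_commutator] at hsm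
    obtain ⟨t, ht, rfl⟩ := hsm
    have := hs t ht
    simpa using congrArg K.subtype this

/-- In a group generated by `a` and `b`, a normal subgroup modulo which `a` and `b` commute
contains the derived subgroup. -/
theorem commutator_le_of_closure_pair {P : Type*} [Group P] {a b : P}
    (hab : Subgroup.closure {a, b} = ⊤) (N : Subgroup P) [N.Normal] (h : ⁅a, b⁆ ∈ N) :
    commutator P ≤ N := by
  rw [← Subgroup.Normal.quotient_commutative_iff_commutator_le]
  have hc : ((a : P ⧸ N)) * b = b * a := by
    rw [← QuotientGroup.mk_mul, ← QuotientGroup.mk_mul, QuotientGroup.eq]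
    have := (inferInstance : N.Normal).conj_mem _ (N.inv_mem h) (b * a)⁻¹
    rw [commutatorElement_def] at this
    convert this using 1
    group
  have htop : Subgroup.closure {(a : P ⧸ N), (b : P ⧸ N)} = ⊤ := by
    have := congrArg (Subgroup.map (QuotientGroup.mk' N)) hab
    rw [MonoidHom.map_closure, Set.image_pair,
      Subgroup.map_top_of_surjective _ (QuotientGroup.mk'_surjective N)] at this
    exact this
  have hcomm : ∀ x ∈ ({(a : P ⧸ N), (b : P ⧸ N)} : Set (P ⧸ N)),
      ∀ y ∈ ({(a : P ⧸ N), (b : P ⧸ N)} : Set (P ⧸ N)), x * y = y * x := by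
    rintro x (rfl | rfl) y (rfl | rfl) <;> first | rfl | exact hc | exact hc.symm
  -- The centralizer of each generator contains both generators, hence is everything; so both
  -- generators are central.
  have hle : (⊤ : Subgroup (P ⧸ N)) ≤ Subgroup.centralizer (⊤ : Subgroup (P ⧸ N)) := by
    conv_lhs => rw [← htop]
    rw [Subgroup.closure_le]
    intro x hx
    rw [SetLike.mem_coe, Subgroup.mem_centralizer_iff]
    intro y hy
    have : (⊤ : Subgroup (P ⧸ N)) ≤ Subgroup.centralizer {x} := by
      rw [← htop, Subgroup.closure_le]
      intro z hz
      rw [SetLike.mem_coe, Subgroup.mem_centralizer_singleton_iff]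
      exact hcomm _ hz _ hx
    exact Subgroup.mem_centralizer_singleton_iff.1 (this hy)
  refine ⟨⟨fun x y => ?_⟩⟩
  exact (Subgroup.mem_centralizer_iff.1 (hle (Subgroup.mem_top x)) y (Subgroup.mem_top y)).symm

/-- A maximal subgroup containing `c` is normal because the group is nilpotent, so it contains the
normal closure. This supplies the smaller group in the inductions on the order below. -/
theorem normalClosure_ne_top_of_zpowers_ne_top {P : Type*} [Group P] [Finite P]
    [Group.IsNilpotent P] {c : P} (hc : Subgroup.zpowers c ≠ ⊤) :
    Subgroup.normalClosure {c} ≠ ⊤ := by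
  obtain ⟨K, hK, hcK⟩ := (eq_top_or_exists_le_coatom (Subgroup.zpowers c)).resolve_left hc
  have : K.Normal :=
    Subgroup.NormalizerCondition.normal_of_coatom K Group.normalizerCondition_of_isNilpotent hK
  intro h
  apply hK.1
  rw [eq_top_iff, ← h]
  apply Subgroup.normalClosure_le_normal
  simpa using hcK (Subgroup.mem_zpowers c)

theorem commute_of_zpowers_eq_top {P : Type*} [Group P] {c : P} (h : Subgroup.zpowers c = ⊤)
    (a b : P) : Commute a b := by
  obtain ⟨i, rfl⟩ := Subgroup.mem_zpowers_iff.1 (h ▸ Subgroup.mem_top a)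
  obtain ⟨j, rfl⟩ := Subgroup.mem_zpowers_iff.1 (h ▸ Subgroup.mem_top b)
  exact Commute.zpow_zpow_self c i j

/-- If products of `n`-torsion elements of a subgroup generated by `n`-torsion elements are
`n`-torsion, so is the whole subgroup. -/
theorem pow_eq_one_of_mem_closure {P : Type*} [Group P] {n : ℕ} {S : Set P}
    (hS : ∀ s ∈ S, s ^ n = 1)
    (hmul : ∀ x ∈ Subgroup.closure S, ∀ y ∈ Subgroup.closure S, x ^ n = 1 → y ^ n = 1 →
      (x * y) ^ n = 1)
    {x : P} (hx : x ∈ Subgroup.closure S) : x ^ n = 1 := by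
  induction hx using Subgroup.closure_induction with
  | mem x h => exact hS x h
  | one => exact one_pow n
  | mul x y hx hy h1 h2 => exact hmul x hx y hy h1 h2
  | inv x _ h => rw [inv_pow, h, inv_one]

theorem pow_eq_one_of_mem_conjugatesOfSet {P : Type*} [Group P] {n : ℕ} {c : P} (hc : c ^ n = 1) :
    ∀ s ∈ Group.conjugatesOfSet {c}, s ^ n = 1 := by
  intro s hs
  obtain ⟨d, hd, h⟩ := Group.mem_conjugatesOfSet_iff.1 hs
  obtain ⟨g, rfl⟩ := isConj_iff.1 h
  rw [conj_pow, Set.mem_singleton_iff.1 hd, hc, mul_one, mul_inv_cancel]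

/-- Induction on the order reduces to `P = ⟨a, b⟩` not generated by `b` alone. The normal closure
`M` of `b` is then proper, so by induction its `n`-torsion elements are closed under products. Being
generated by conjugates of `b`, all of `M` is `n`-torsion, and it contains the derived subgroup. -/
theorem WeaklyRegular.mul_pow_of_pow_eq_one {n : ℕ} (N : ℕ) :
    ∀ (P : Type u) [Group P] [Finite P] [Group.IsNilpotent P], Nat.card P = N →
      WeaklyRegular n P → ∀ a b : P, b ^ n = 1 → (a * b) ^ n = a ^ n := by
  induction N using Nat.strong_induction_on with
  | _ N ih =>
  intro P _ _ _ hcard hP a b hb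
  by_cases htop : Subgroup.closure {a, b} = ⊤
  · by_cases hz : Subgroup.zpowers b = ⊤
    · rw [(commute_of_zpowers_eq_top hz a b).mul_pow, hb, mul_one]
    · have hN := normalClosure_ne_top_of_zpowers_ne_top hz
      set M := Subgroup.normalClosure {b} with hM
      have hbM : b ∈ M := Subgroup.subset_normalClosure rfl
      have hlt : Nat.card M < N := by
        rw [← hcard]
        exact lt_of_le_of_ne (Subgroup.card_le_card_group M)
          fun e => hN (Subgroup.eq_top_of_card_eq M e)
      have htor : ∀ x ∈ M, x ^ n = 1 := by
        intro x hx
        refine pow_eq_one_of_mem_closure (pow_eq_one_of_mem_conjugatesOfSet hb) ?_ hx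
        intro x hx y hy h1 h2
        have := ih _ hlt M rfl (hP.subgroup M) ⟨x, hx⟩ ⟨y, hy⟩ (Subtype.ext h2)
        rw [← h1]
        exact congrArg Subtype.val this
      have hle : commutator P ≤ M := by
        apply commutator_le_of_closure_pair htop
        rw [commutatorElement_def]
        exact M.mul_mem ((inferInstance : M.Normal).conj_mem _ hbM a) (M.inv_mem hbM)
      rw [hP a b, hb, mul_one]
      intro s hs
      rw [htop] at hs
      exact htor s (hle hs)
  · set K := Subgroup.closure {a, b} with hK
    have hlt : Nat.card K < N := by
      rw [← hcard]
      exact lt_of_le_of_ne (Subgroup.card_le_card_group K)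
        fun e => htop (Subgroup.eq_top_of_card_eq K e)
    have := ih _ hlt K rfl (hP.subgroup K)
      ⟨a, Subgroup.subset_closure (by simp)⟩ ⟨b, Subgroup.subset_closure (by simp)⟩
      (Subtype.ext hb)
    exact congrArg Subtype.val this

/-- The same induction, now with the normal closure `M` of `a`. Both `a` and its conjugate by `b`
lie in `M` and have equal `n`-th powers, so their quotient, a commutator, is `n`-torsion. Its
conjugates generate a subgroup containing the derived subgroup, which is `n`-torsion by the previous
theorem. -/
theorem WeaklyRegular.inv_mul_pow_eq_one {n : ℕ} (N : ℕ) :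
    ∀ (P : Type u) [Group P] [Finite P] [Group.IsNilpotent P], Nat.card P = N →
      WeaklyRegular n P → ∀ a b : P, a ^ n = b ^ n → (a⁻¹ * b) ^ n = 1 := by
  induction N using Nat.strong_induction_on with
  | _ N ih =>
  intro P _ _ _ hcard hP a b hab
  by_cases htop : Subgroup.closure {a, b} = ⊤
  · by_cases hz : Subgroup.zpowers a = ⊤
    · rw [(commute_of_zpowers_eq_top hz _ _).mul_pow, inv_pow, hab, inv_mul_cancel]
    · have hN := normalClosure_ne_top_of_zpowers_ne_top hz
      set M := Subgroup.normalClosure {a} with hM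
      have haM : a ∈ M := Subgroup.subset_normalClosure rfl
      have hlt : Nat.card M < N := by
        rw [← hcard]
        exact lt_of_le_of_ne (Subgroup.card_le_card_group M)
          fun e => hN (Subgroup.eq_top_of_card_eq M e)
      have hcM : b⁻¹ * a * b ∈ M := by
        simpa using (inferInstance : M.Normal).conj_mem _ haM b⁻¹
      -- Here `a ^ n = b ^ n` commutes with `b`.
      have hconj : (b⁻¹ * a * b) ^ n = a ^ n := by
        have : (b⁻¹ * a * b⁻¹⁻¹) ^ n = b⁻¹ * a ^ n * b⁻¹⁻¹ := conj_pow
        rw [inv_inv] at this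
        rw [this, hab, mul_assoc, ← pow_succ, pow_succ', inv_mul_cancel_left]
      have hcomm : ⁅a⁻¹, b⁻¹⁆ ^ n = 1 := by
        have := ih _ hlt M rfl (hP.subgroup M) ⟨a, haM⟩ ⟨_, hcM⟩ (Subtype.ext hconj.symm)
        have := congrArg Subtype.val this
        rw [commutatorElement_def, inv_inv, inv_inv]
        simpa [mul_assoc] using this
      have hle : commutator P ≤ Subgroup.normalClosure {⁅a⁻¹, b⁻¹⁆} := by
        apply commutator_le_of_closure_pair (a := a⁻¹) (b := b⁻¹)
        · rw [eq_top_iff, ← htop, Subgroup.closure_le]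
          rintro x (rfl | rfl)
          · exact inv_mem_iff.1 (Subgroup.subset_closure (by simp))
          · exact inv_mem_iff.1 (Subgroup.subset_closure (by simp))
        · exact Subgroup.subset_normalClosure rfl
      rw [hP, inv_pow, hab, inv_mul_cancel]
      intro s hs
      refine pow_eq_one_of_mem_closure (pow_eq_one_of_mem_conjugatesOfSet hcomm) ?_
        (hle (Subgroup.commutator_mono le_top le_top hs))
      intro x _ y _ h1 h2
      rw [WeaklyRegular.mul_pow_of_pow_eq_one _ P rfl hP x y h2, h1]
  · set K := Subgroup.closure {a, b} with hK
    have hlt : Nat.card K < N := by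
      rw [← hcard]
      exact lt_of_le_of_ne (Subgroup.card_le_card_group K)
        fun e => htop (Subgroup.eq_top_of_card_eq K e)
    have := ih _ hlt K rfl (hP.subgroup K)
      ⟨a, Subgroup.subset_closure (by simp)⟩ ⟨b, Subgroup.subset_closure (by simp)⟩
      (Subtype.ext hab)
    exact congrArg Subtype.val this

theorem WeaklyRegular.powEqIff {n : ℕ} {P : Type u} [Group P] [Finite P] [Group.IsNilpotent P]
    (h : WeaklyRegular n P) : PowEqIffQuotientTorsion n P := by
  intro a b
  refine ⟨h.inv_mul_pow_eq_one _ P rfl a b, fun hab => ?_⟩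
  have := h.mul_pow_of_pow_eq_one _ P rfl a _ hab
  rw [← this, mul_inv_cancel_left]

theorem IsRegularPGroup.powEqIff {p : ℕ} {P : Type u} [Group P] [Finite P]
    (h : IsRegularPGroup p P) {n : ℕ} (hn : 0 < n) : PowEqIffQuotientTorsion n P := by
  have : Fact p.Prime := ⟨h.1⟩
  have : Group.IsNilpotent P := h.2.1.isNilpotent
  -- Raising to a power prime to `p` is bijective on a `p`-group, so only the `p`-part of `n`
  -- matters.
  obtain ⟨α, k, hk, rfl⟩ := Nat.exists_eq_pow_mul_and_not_dvd hn.ne' p h.1.ne_one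
  have hcop : p.Coprime k := (Nat.Prime.coprime_iff_not_dvd h.1).2 hk
  have hinj : ∀ x y : P, x ^ (p ^ α * k) = y ^ (p ^ α * k) ↔ x ^ p ^ α = y ^ p ^ α := by
    intro x y
    rw [pow_mul, pow_mul]
    exact (h.2.1.powEquiv hcop).injective.eq_iff
  intro a b
  rw [hinj, (h.weaklyRegular α).powEqIff a b]
  have := hinj (a⁻¹ * b) 1
  rw [one_pow, one_pow] at this
  exact this.symm

theorem PowEqIffQuotientTorsion.of_injective {n : ℕ} {P Q : Type*} [Group P] [Group Q]
    (h : PowEqIffQuotientTorsion n Q) (f : P →* Q) (hf : Function.Injective f) :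
    PowEqIffQuotientTorsion n P := by
  intro a b
  rw [← hf.eq_iff, map_pow, map_pow, h, ← hf.eq_iff, map_pow, map_mul, map_inv, map_one]

theorem PowEqIffQuotientTorsion.pi {n : ℕ} {ι : Type*} {P : ι → Type*} [∀ i, Group (P i)]
    (h : ∀ i, PowEqIffQuotientTorsion n (P i)) : PowEqIffQuotientTorsion n (∀ i, P i) := by
  intro a b
  rw [funext_iff, funext_iff]
  exact forall_congr' fun i => h i (a i) (b i)

theorem IsProdOfRegularPGroups.powEqIff {C : Type u} [Group C] [Finite C]
    (h : IsProdOfRegularPGroups C) {n : ℕ} (hn : 0 < n) : PowEqIffQuotientTorsion n C := by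
  obtain ⟨k, p, P, _, hP, ⟨e⟩⟩ := h
  refine PowEqIffQuotientTorsion.of_injective (PowEqIffQuotientTorsion.pi fun i => ?_)
    e.toMonoidHom e.injective
  have : Finite (P i) := Finite.of_surjective (fun c => e c i)
    ((Function.surjective_eval i).comp e.surjective)
  exact (hP i).powEqIff hn

theorem IsRegularNilpotent.powEqIff {C : Type u} [Group C] [Finite C]
    (h : IsRegularNilpotent C) {n : ℕ} (hn : 0 < n) : PowEqIffQuotientTorsion n C := by
  obtain ⟨e⟩ := (Group.isNilpotent_of_finite_tfae.out 0 4).1 h.1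
  refine PowEqIffQuotientTorsion.of_injective
    (PowEqIffQuotientTorsion.pi fun p => PowEqIffQuotientTorsion.pi fun P => ?_)
    e.symm.toMonoidHom e.symm.injective
  exact (h.2 p (Nat.prime_of_mem_primeFactors p.2) P).powEqIff hn

end

noncomputable section

/-! ### Counting common `n`-th roots -/

section Counting

open Classical in
/-- The number of `y` such that `y` and `u y` are both `n`-th roots of `g`. -/
def commonRootCount {G : Type*} [Group G] [Fintype G] (n : ℕ) (u g : G) : ℕ :=
  (Finset.univ.filter fun y : G => y ^ n = g ∧ (u * y) ^ n = g).card

/-- As a power of both `y` and `u * y`, the element `g` commutes with both, hence with `u`. -/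
theorem mem_centralizer_of_commonRootCount_ne_zero {G : Type*} [Group G] [Fintype G] {n : ℕ}
    {u g : G} (h : commonRootCount n u g ≠ 0) : g ∈ Subgroup.centralizer {u} := by
  classical
  obtain ⟨y, hy⟩ := Finset.card_ne_zero.1 h
  obtain ⟨-, h1, h2⟩ := Finset.mem_filter.1 hy
  have c1 : Commute g y := h1 ▸ (Commute.refl y).pow_left n
  have c2 : Commute g (u * y) := h2 ▸ (Commute.refl (u * y)).pow_left n
  rw [Subgroup.mem_centralizer_singleton_iff]
  have := c2.mul_right c1.inv_right
  rw [mul_inv_cancel_right] at this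
  exact this.eq

theorem PowEqIffQuotientTorsion.pow_eq_mul_pow_iff {n : ℕ} {C : Type*} [Group C]
    (hC : PowEqIffQuotientTorsion n C) (u y : C) : y ^ n = (u * y) ^ n ↔ u ^ n = 1 := by
  have : (y⁻¹ * u * y⁻¹⁻¹) ^ n = y⁻¹ * u ^ n * y⁻¹⁻¹ := conj_pow
  rw [hC, ← mul_assoc]
  rw [inv_inv] at this
  rw [this, mul_assoc, inv_mul_eq_one, eq_comm, mul_eq_right]

-- Left translation by `y₀⁻¹` carries the roots of `y₀ ^ n` onto the `n`-torsion elements.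
open Classical in
theorem PowEqIffQuotientTorsion.card_roots {n : ℕ} {C : Type*} [Group C]
    [Fintype C] (hC : PowEqIffQuotientTorsion n C) (y₀ : C) :
    (Finset.univ.filter fun y : C => y ^ n = y₀ ^ n).card =
      (Finset.univ.filter fun y : C => y ^ n = 1).card := by
  refine Finset.card_bijective (fun y => y₀⁻¹ * y) (Group.mulLeft_bijective _) fun y => ?_
  simp only [Finset.mem_filter, Finset.mem_univ, true_and]
  rw [← hC]
  exact eq_comm

theorem PowEqIffQuotientTorsion.commonRootCount_eq {n : ℕ} {C : Type*} [Group C]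
    [Fintype C] (hC : PowEqIffQuotientTorsion n C) (u : C) {g g' : C}
    (hg : Subgroup.zpowers g = Subgroup.zpowers g') :
    commonRootCount n u g = commonRootCount n u g' := by
  classical
  by_cases hu : u ^ n = 1
  · have e : ∀ g : C, commonRootCount n u g = (Finset.univ.filter fun y : C => y ^ n = g).card := by
      intro g
      unfold commonRootCount
      congr 1
      ext y
      have := (hC.pow_eq_mul_pow_iff u y).2 hu
      simp only [Finset.mem_filter, Finset.mem_univ, true_and, ← this, and_self]
    -- If `y` is a root of `g` and `g' = g ^ m`, then `y ^ m` is a root of `g'`.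
    have key : ∀ g g' : C, Subgroup.zpowers g = Subgroup.zpowers g' → ∀ y, y ^ n = g →
        ∃ z, z ^ n = g' := by
      rintro _ g' hg y rfl
      obtain ⟨m, rfl⟩ := Subgroup.mem_zpowers_iff.1 (hg ▸ Subgroup.mem_zpowers g')
      exact ⟨y ^ m, by rw [← zpow_natCast, ← zpow_natCast, ← zpow_mul, ← zpow_mul, mul_comm]⟩
    rw [e, e]
    by_cases hy : ∃ y, y ^ n = g
    · obtain ⟨y, hy⟩ := hy
      obtain ⟨z, hz⟩ := key g g' hg y hy
      subst hy hz
      rw [hC.card_roots, hC.card_roots]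
    · have hz : ¬ ∃ z, z ^ n = g' := fun ⟨z, hz⟩ => hy (key g' g hg.symm z hz)
      push Not at hy hz
      simp [hy, hz]
  · have e : ∀ g : C, commonRootCount n u g = 0 := by
      intro g
      rw [commonRootCount, Finset.card_eq_zero, Finset.filter_eq_empty_iff]
      rintro y - ⟨h1, h2⟩
      exact hu ((hC.pow_eq_mul_pow_iff u y).1 (h1.trans h2.symm))
    rw [e, e]

/-- The roots of `g` lie in any subgroup containing the centralizer of `g`. -/
theorem commonRootCount_subgroup {G : Type*} [Group G] [Fintype G] {n : ℕ} (K : Subgroup G)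
    [Fintype K] (u g : K) (hK : Subgroup.centralizer {(g : G)} ≤ K) :
    commonRootCount n u g = commonRootCount n (u : G) (g : G) := by
  classical
  unfold commonRootCount
  refine Finset.card_bij (fun y _ => (y : G)) ?_ ?_ ?_
  · intro y hy
    simp only [Finset.mem_filter, Finset.mem_univ, true_and] at hy ⊢
    exact_mod_cast hy
  · intro y _ z _ h
    exact Subtype.ext h
  · intro y hy
    simp only [Finset.mem_filter, Finset.mem_univ, true_and] at hy
    have hyK : y ∈ K := hK (Subgroup.mem_centralizer_singleton_iff.2 <| by
      rw [← hy.1, ← pow_succ, ← pow_succ'])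
    refine ⟨⟨y, hyK⟩, ?_, rfl⟩
    simp only [Finset.mem_filter, Finset.mem_univ, true_and]
    exact ⟨Subtype.ext hy.1, Subtype.ext hy.2⟩

theorem centralizer_singleton_eq_of_zpowers_eq {G : Type*} [Group G] {g g' : G}
    (hg : Subgroup.zpowers g = Subgroup.zpowers g') :
    Subgroup.centralizer {g} = Subgroup.centralizer {g'} := by
  rw [← Subgroup.centralizer_closure {g}, ← Subgroup.centralizer_closure {g'},
    ← Subgroup.zpowers_eq_closure, ← Subgroup.zpowers_eq_closure, hg]

/-- `g` and `g'` have the same centralizer. If it contains `u`, both counts can be made inside it;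
otherwise both vanish. -/
theorem commonRootCount_eq_of_centralizer {n : ℕ} {G : Type*} [Group G] [Fintype G] (u : G)
    {g g' : G} (hC : PowEqIffQuotientTorsion n (Subgroup.centralizer {g}))
    (hg : Subgroup.zpowers g = Subgroup.zpowers g') :
    commonRootCount n u g = commonRootCount n u g' := by
  classical
  have hc := centralizer_singleton_eq_of_zpowers_eq hg
  by_cases hu : u ∈ Subgroup.centralizer {g}
  · have hgm : g ∈ Subgroup.centralizer {g} := Subgroup.mem_centralizer_singleton_iff.2 rfl
    have hgm' : g' ∈ Subgroup.centralizer {g} :=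
      hc ▸ Subgroup.mem_centralizer_singleton_iff.2 rfl
    have h1 := commonRootCount_subgroup (n := n) _ ⟨u, hu⟩ ⟨g, hgm⟩ le_rfl
    have h2 := commonRootCount_subgroup (n := n) _ ⟨u, hu⟩ ⟨g', hgm'⟩ hc.ge
    refine h1.symm.trans ((hC.commonRootCount_eq _ ?_).trans h2)
    apply Subgroup.map_injective (Subgroup.centralizer {g}).subtype_injective
    rw [MonoidHom.map_zpowers, MonoidHom.map_zpowers]
    exact hg
  · have key : ∀ k : G, u ∉ Subgroup.centralizer {k} → commonRootCount n u k = 0 := by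
      intro k hk
      by_contra h
      apply hk
      rw [Subgroup.mem_centralizer_singleton_iff]
      exact (Subgroup.mem_centralizer_singleton_iff.1
        (mem_centralizer_of_commonRootCount_ne_zero h)).symm
    rw [key g hu, key g' (hc ▸ hu)]

theorem IsRegularCNGroup.commonRootCount_eq {n : ℕ} (hn : 0 < n) {G : Type u} [Group G] [Fintype G]
    (hG : IsRegularCNGroup G) (u : G) {g g' : G}
    (hg : Subgroup.zpowers g = Subgroup.zpowers g') :
    commonRootCount n u g = commonRootCount n u g' := by
  by_cases h : g = 1
  -- The centralizer of `1` is all of `G`, about which nothing is assumed, but `⟨g'⟩ = ⟨1⟩` forces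
  -- `g' = 1`.
  · subst h
    rw [Subgroup.zpowers_one_eq_bot, eq_comm, Subgroup.zpowers_eq_bot] at hg
    rw [hg]
  · exact commonRootCount_eq_of_centralizer u ((hG g h).powEqIff hn) hg

end Counting

/-! ### From sums over subgroups to sums over generators of cyclic subgroups -/

section SumOverGenerators

variable {G : Type*} [Group G] [Fintype G]

-- The sum over `K` splits according to the cyclic subgroup each element generates. The pieces from
-- proper subgroups lie in `S` by induction, so the remaining one does too. For non-cyclic `K` that
-- piece is an empty sum.
open Classical in
theorem sum_generators_mem {R : Type*} [CommRing R] (S : Subring R) (f : G → R)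
    (Z : Subgroup G) (hf : ∀ K ≤ Z, ∑ h : K, f h ∈ S) (K : Subgroup G) (hK : K ≤ Z) :
    ∑ g with Subgroup.zpowers g = K, f g ∈ S := by
  induction K using WellFoundedLT.induction with
  | _ K ih =>
  have h1 := hf K hK
  have h2 : ∑ h : K, f h = ∑ L : Subgroup G with L ≤ K, ∑ g with Subgroup.zpowers g = L, f g := by
    rw [← Finset.sum_subtype (Finset.univ.filter (· ∈ K)) (by simp) f,
      ← Finset.sum_fiberwise_of_maps_to (g := fun g => Subgroup.zpowers g)
        (t := Finset.univ.filter (· ≤ K)) (by simp)]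
    refine Finset.sum_congr rfl fun L hL => Finset.sum_congr ?_ fun _ _ => rfl
    ext g
    simp only [Finset.mem_filter, Finset.mem_univ, true_and] at hL ⊢
    refine ⟨fun h => h.2, fun h => ⟨hL ?_, h⟩⟩
    rw [← h]
    exact Subgroup.mem_zpowers g
  rw [h2, ← Finset.add_sum_erase _ _ (a := K) (by simp)] at h1
  refine (S.add_mem_cancel_right ?_).1 h1
  refine S.sum_mem fun L hL => ?_
  simp only [Finset.mem_erase, Finset.mem_filter, Finset.mem_univ, true_and] at hL
  exact ih L (lt_of_le_of_ne hL.2 hL.1) (hL.2.trans hK)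

open Classical in
theorem sum_mul_mem_of_const_on_generators {R : Type*} [CommRing R] (S : Subring R) (f : G → R)
    (Z : Subgroup G) (hf : ∀ K ≤ Z, ∑ h : K, f h ∈ S) (w : G → ℕ) (hw : ∀ g, w g ≠ 0 → g ∈ Z)
    (hwc : ∀ g g', Subgroup.zpowers g = Subgroup.zpowers g' → w g = w g') :
    ∑ g, (w g : R) * f g ∈ S := by
  classical
  rw [← Finset.sum_fiberwise (s := Finset.univ) (g := fun g : G => Subgroup.zpowers g)]
  refine S.sum_mem fun K _ => ?_
  -- A generator of nonzero weight lies in `Z`, which places `K` inside `Z`; without one the whole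
  -- fibre contributes zero.
  by_cases hK : ∃ g, Subgroup.zpowers g = K ∧ w g ≠ 0
  · obtain ⟨g, rfl, hg⟩ := hK
    have : ∑ x with Subgroup.zpowers x = Subgroup.zpowers g, (w x : R) * f x =
        (w g : R) * ∑ x with Subgroup.zpowers x = Subgroup.zpowers g, f x := by
      rw [Finset.mul_sum]
      refine Finset.sum_congr rfl fun x hx => ?_
      rw [hwc x g (Finset.mem_filter.1 hx).2]
    rw [this]
    exact S.mul_mem (natCast_mem S _) (sum_generators_mem S f Z hf _
      (Subgroup.zpowers_le.2 (hw g hg)))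
  · push Not at hK
    rw [Finset.sum_eq_zero]
    · exact S.zero_mem
    · intro x hx
      rw [hK x (Finset.mem_filter.1 hx).2, Nat.cast_zero, zero_mul]

end SumOverGenerators

/-! ### The indicator formula and its rationality -/

namespace DrinfeldDouble

variable {G : Type u} [Group G] [Fintype G]

theorem sweedlerPow_succ_basisElt (n : ℕ) (g x : G) :
    sweedlerPow (DrinfeldDouble G) (n + 1) (basisElt g x) =
      ∑ a, sweedlerPow (DrinfeldDouble G) n (basisElt a x) * basisElt (a⁻¹ * g) x := by
  simp only [sweedlerPow, LinearMap.comp_apply, comul_basisElt, map_sum, LinearMap.rTensor_tmul,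
    LinearMap.mul'_apply]

-- A product of `e_{a_i} # x` survives only if each `a_{i+1}` is `x⁻¹ * a_i * x`; the product of
-- such a chain starting at `a` telescopes to `(a * x⁻¹) ^ n * x ^ n`.
open Classical in
theorem sweedlerPow_basisElt (n : ℕ) (g x : G) :
    sweedlerPow (DrinfeldDouble G) n (basisElt g x) =
      ∑ a, if (a * x⁻¹) ^ n * x ^ n = g then basisElt a (x ^ n) else 0 := by
  induction n generalizing g with
  | zero =>
    simp only [sweedlerPow, LinearMap.comp_apply, counit_basisElt, pow_zero, mul_one,
      Algebra.linearMap_apply]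
    by_cases hg : g = 1
    · simp [hg, one_eq_sum]
    · simp [hg, Ne.symm hg]
  | succ n ih =>
    rw [sweedlerPow_succ_basisElt]
    simp only [ih, Finset.sum_mul, ite_mul, zero_mul, basisElt_mul_basisElt]
    rw [Finset.sum_comm]
    refine Finset.sum_congr rfl fun a _ => ?_
    rw [Finset.sum_ite_eq, if_pos (Finset.mem_univ _), ← pow_succ]
    refine if_congr ?_ rfl rfl
    rw [eq_mul_inv_iff_mul_eq, ← inv_mul_eq_iff_eq_mul, eq_inv_mul_iff_mul_eq,
      pow_succ (a * x⁻¹), pow_succ' x]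
    simp only [mul_assoc, inv_mul_cancel_left, mul_inv_cancel_left]

variable (V : Type v) [AddCommGroup V] [Module ℂ V] [Module (DrinfeldDouble G) V]
  [IsScalarTower ℂ (DrinfeldDouble G) V]

/-- The character of a module as a linear functional. -/
def characterLin : DrinfeldDouble G →ₗ[ℂ] ℂ :=
  LinearMap.trace ℂ V ∘ₗ (Algebra.lsmul ℂ ℂ V).toLinearMap

theorem characterLin_apply (h : DrinfeldDouble G) : characterLin V h = moduleCharacter V h := rfl

theorem moduleCharacter_isIdempotentElem [Module.Finite ℂ V] {e : DrinfeldDouble G}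
    (he : IsIdempotentElem e) : moduleCharacter V e ∈ (Int.castRingHom ℂ).range := by
  have h : IsIdempotentElem (Algebra.lsmul ℂ ℂ V e) := he.map (Algebra.lsmul ℂ ℂ V)
  rw [moduleCharacter, (LinearMap.IsIdempotentElem.isProj_range _ h).trace]
  exact ⟨Module.finrank ℂ (LinearMap.range (Algebra.lsmul ℂ ℂ V e)), by simp⟩

-- The elements `e_a # h⁻¹` with `h` in `K` multiply like a group because `K` fixes `a` under
-- conjugation.
open Classical in
theorem isIdempotentElem_subgroup_average {a : G} {K : Subgroup G}
    (hK : K ≤ Subgroup.centralizer {a}) :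
    IsIdempotentElem ((Nat.card K : ℂ)⁻¹ • ∑ h : K, basisElt a (h : G)⁻¹) := by
  classical
  have hmul : ∀ h k : K, basisElt a (h : G)⁻¹ * basisElt a (k : G)⁻¹ =
      basisElt a ((k * h : K) : G)⁻¹ := by
    intro h k
    have hc : a * h = h * a := (Subgroup.mem_centralizer_singleton_iff.1 (hK h.2)).symm
    rw [basisElt_mul_basisElt, if_pos]
    · simp
    · rw [inv_inv, mul_assoc, hc, inv_mul_cancel_left]
  have hsq : (∑ h : K, basisElt a (h : G)⁻¹) * (∑ h : K, basisElt a (h : G)⁻¹) =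
      (Nat.card K : ℂ) • ∑ h : K, basisElt a (h : G)⁻¹ := by
    simp only [Finset.sum_mul, Finset.mul_sum, hmul]
    have : ∀ h : K, ∑ k : K, basisElt a ((k * h : K) : G)⁻¹ = ∑ k : K, basisElt a (k : G)⁻¹ :=
      fun h => Equiv.sum_comp (Equiv.mulRight h) (fun k : K => basisElt a (k : G)⁻¹)
    rw [Finset.sum_comm]
    simp only [this, Finset.sum_const, Finset.card_univ, Nat.card_eq_fintype_card]
    rw [Nat.cast_smul_eq_nsmul]
  have hne : (Nat.card K : ℂ) ≠ 0 := by exact_mod_cast Nat.card_pos.ne'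
  rw [IsIdempotentElem, smul_mul_smul_comm, hsq, smul_smul, mul_assoc, inv_mul_cancel₀ hne, mul_one]

open Classical in
theorem sum_moduleCharacter_subgroup_mem [Module.Finite ℂ V] {a : G} {K : Subgroup G}
    (hK : K ≤ Subgroup.centralizer {a}) :
    ∑ h : K, moduleCharacter V (basisElt a (h : G)⁻¹) ∈ (Int.castRingHom ℂ).range := by
  have h := moduleCharacter_isIdempotentElem V (isIdempotentElem_subgroup_average hK)
  have hne : (Nat.card K : ℂ) ≠ 0 := by exact_mod_cast Nat.card_pos.ne'
  have e : ∑ h : K, moduleCharacter V (basisElt a (h : G)⁻¹) = (Nat.card K : ℂ) *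
      moduleCharacter V ((Nat.card K : ℂ)⁻¹ • ∑ h : K, basisElt a (h : G)⁻¹) := by
    simp only [← characterLin_apply, map_smul, map_sum, smul_eq_mul]
    rw [mul_inv_cancel_left₀ hne]
  rw [e]
  exact Subring.mul_mem _ (natCast_mem _ _) h

theorem card_mul_frobeniusSchurIndicator (n : ℕ) :
    (Fintype.card G : ℂ) * frobeniusSchurIndicator (integral G) n V =
      ∑ a : G, ∑ g : G, (commonRootCount n a g : ℂ) * moduleCharacter V (basisElt a g⁻¹) := by
  classical
  have hne : (Fintype.card G : ℂ) ≠ 0 := by exact_mod_cast Fintype.card_ne_zero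
  -- With `y = x⁻¹` the condition `(a * x⁻¹) ^ n * x ^ n = 1` becomes `(a * y) ^ n = y ^ n`; the sum
  -- is then sorted by this common value `g`.
  rw [frobeniusSchurIndicator, integral, map_smul, ← characterLin_apply, map_smul, smul_eq_mul,
    mul_inv_cancel_left₀ hne, map_sum, map_sum, ← Equiv.sum_comp (Equiv.inv G)]
  simp only [sweedlerPow_basisElt, map_sum]
  rw [Finset.sum_comm]
  refine Finset.sum_congr rfl fun a _ => ?_
  rw [← Finset.sum_fiberwise (s := Finset.univ) (g := fun y : G => y ^ n)]
  refine Finset.sum_congr rfl fun g _ => ?_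
  rw [commonRootCount, Finset.card_filter, Finset.sum_filter, Nat.cast_sum, Finset.sum_mul]
  refine Finset.sum_congr rfl fun y _ => ?_
  by_cases h : y ^ n = g
  · subst h
    simp [mul_inv_eq_one, apply_ite (characterLin V), ← characterLin_apply]
  · simp [h]

theorem card_mul_frobeniusSchurIndicator_mem [Module.Finite ℂ V] (n : ℕ)
    (hG : ∀ u g g' : G, Subgroup.zpowers g = Subgroup.zpowers g' →
      commonRootCount n u g = commonRootCount n u g') :
    (Fintype.card G : ℂ) * frobeniusSchurIndicator (integral G) n V ∈
      (Int.castRingHom ℂ).range := by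
  rw [card_mul_frobeniusSchurIndicator]
  refine Subring.sum_mem _ fun a _ => ?_
  exact sum_mul_mem_of_const_on_generators _ (fun g => moduleCharacter V (basisElt a g⁻¹))
    (Subgroup.centralizer {a}) (fun K hK => sum_moduleCharacter_subgroup_mem V hK) _
    (fun g => mem_centralizer_of_commonRootCount_ne_zero) (hG a)

end DrinfeldDouble

end

noncomputable section

/-! ### Tensor powers of matrices and the cyclic shift -/

section CyclicShift

open Matrix

variable {I : Type*} {n : ℕ}

/-- The tensor product of matrices, acting on functions `Fin n → I`. -/
def tensorMatrix (A : Fin n → Matrix I I ℂ) : Matrix (Fin n → I) (Fin n → I) ℂ :=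
  Matrix.of fun i j => ∏ k, A k (i k) (j k)

theorem tensorMatrix_mul [Fintype I] (A B : Fin n → Matrix I I ℂ) :
    tensorMatrix A * tensorMatrix B = tensorMatrix fun k => A k * B k := by
  ext i j
  simp only [tensorMatrix, Matrix.mul_apply, Matrix.of_apply, ← Finset.prod_mul_distrib]
  rw [Finset.prod_univ_sum, Fintype.piFinset_univ]

theorem tensorMatrix_eq_zero {A : Fin n → Matrix I I ℂ} {k : Fin n} (h : A k = 0) :
    tensorMatrix A = 0 := by
  ext i j
  exact Finset.prod_eq_zero (Finset.mem_univ k) (by rw [h]; rfl)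

variable [Fintype I] [DecidableEq I]

variable (I n) in
/-- The cyclic permutation of the tensor factors. -/
def cyclicShift : Matrix (Fin n → I) (Fin n → I) ℂ :=
  Equiv.Perm.permMatrix ℂ ((finRotate n).arrowCongr (Equiv.refl I))

theorem mul_cyclicShift_apply (M : Matrix (Fin n → I) (Fin n → I) ℂ) (i j : Fin n → I) :
    (M * cyclicShift I n) i j = M i (j ∘ finRotate n) := by
  rw [cyclicShift, Equiv.Perm.permMatrix, PEquiv.mul_toMatrix_toPEquiv]
  rfl

theorem cyclicShift_mul_apply (M : Matrix (Fin n → I) (Fin n → I) ℂ) (i j : Fin n → I) :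
    (cyclicShift I n * M) i j = M (i ∘ (finRotate n).symm) j := by
  rw [cyclicShift, Equiv.Perm.permMatrix, PEquiv.toMatrix_toPEquiv_mul]
  rfl

theorem tensorMatrix_mul_cyclicShift (A : Fin n → Matrix I I ℂ) :
    tensorMatrix (fun k => A (finRotate n k)) * cyclicShift I n =
      cyclicShift I n * tensorMatrix A := by
  ext i j
  rw [mul_cyclicShift_apply, cyclicShift_mul_apply, tensorMatrix, tensorMatrix, Matrix.of_apply,
    Matrix.of_apply, ← Equiv.prod_comp (finRotate n) fun k => A k ((i ∘ (finRotate n).symm) k) (j k)]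
  simp only [Function.comp_apply, Equiv.symm_apply_apply]

variable (I n) in
theorem exists_cyclicShift_pow_eq_one : ∃ m, 0 < m ∧ cyclicShift I n ^ m = 1 := by
  set σ : Equiv.Perm (Fin n → I) := (finRotate n).arrowCongr (Equiv.refl I) with hσ
  refine ⟨orderOf σ⁻¹, orderOf_pos _, ?_⟩
  have : cyclicShift I n = Matrix.permMatrixHom (R := ℂ) σ⁻¹ := by
    change _ = Equiv.Perm.permMatrix ℂ σ⁻¹⁻¹
    rw [inv_inv]
    rfl
  rw [this, ← map_pow, pow_orderOf_eq_one, map_one]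

/-- Sum over paths from `i` to `j` with intermediate vertices `p`; `Fin.cons i p` lists the sources
of the steps and `Fin.snoc p j` their targets. -/
theorem list_prod_apply (n : ℕ) (A : Fin (n + 1) → Matrix I I ℂ) (i j : I) :
    (List.ofFn A).prod i j = ∑ p : Fin n → I, ∏ k,
      A k (Fin.cons (α := fun _ => I) i p k) (Fin.snoc (α := fun _ => I) p j k) := by
  induction n generalizing i with
  | zero => simp [Fin.snoc]
  | succ n ih =>
    rw [List.ofFn_succ, List.prod_cons, Matrix.mul_apply,
      ← (Fin.consEquiv (n := n) (fun _ => I)).sum_comp, Fintype.sum_prod_type]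
    refine Finset.sum_congr rfl fun l _ => ?_
    rw [ih, Finset.mul_sum]
    refine Finset.sum_congr rfl fun q _ => ?_
    have : (Fin.consEquiv fun _ => I) (l, q) = Fin.cons (α := fun _ => I) l q := rfl
    rw [this, Fin.prod_univ_succ (n := n + 1), ← Fin.cons_snoc_eq_snoc_cons]
    simp only [Fin.cons_zero, Fin.cons_succ]

/-- Both sides are sums over closed paths: when `j = i`, the targets are the rotated sources. -/
theorem trace_tensorMatrix_mul_cyclicShift (hn : 0 < n) (A : Fin n → Matrix I I ℂ) :
    (tensorMatrix A * cyclicShift I n).trace = (List.ofFn A).prod.trace := by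
  obtain ⟨n, rfl⟩ := Nat.exists_eq_succ_of_ne_zero hn.ne'
  simp only [Matrix.trace, Matrix.diag_apply, mul_cyclicShift_apply, list_prod_apply]
  rw [← (Fin.consEquiv (n := n) (fun _ => I)).sum_comp, Fintype.sum_prod_type]
  refine Finset.sum_congr rfl fun i _ => Finset.sum_congr rfl fun p _ => ?_
  simp only [Fin.snoc_eq_cons_rotate, tensorMatrix, Matrix.of_apply, Fin.consEquiv_apply,
    Function.comp_apply]

/-- Every eigenvalue is a root of the monic integer polynomial `X ^ (m + 1) - X`. -/
theorem isIntegral_trace_of_pow_succ_eq {J : Type*} [Fintype J] [DecidableEq J]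
    {T : Matrix J J ℂ} {m : ℕ} (hm : 0 < m) (hT : T ^ (m + 1) = T) : IsIntegral ℤ T.trace := by
  rw [Matrix.trace_eq_sum_roots_charpoly]
  refine IsIntegral.multiset_sum fun r hr => ?_
  have hr' : r ∈ spectrum ℂ T := by
    rw [Matrix.mem_spectrum_iff_isRoot_charpoly]
    exact Polynomial.isRoot_of_mem_roots hr
  have h0 : Polynomial.aeval T (Polynomial.X ^ (m + 1) - Polynomial.X : Polynomial ℂ) = 0 := by
    simp [hT]
  have h1 := spectrum.subset_polynomial_aeval T (Polynomial.X ^ (m + 1) - Polynomial.X)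
    ⟨r, hr', rfl⟩
  have : Nontrivial (Matrix J J ℂ) := by
    by_contra h
    rw [not_nontrivial_iff_subsingleton] at h
    simp [spectrum.of_subsingleton] at hr'
  rw [h0, spectrum.zero_eq] at h1
  refine ⟨Polynomial.X ^ (m + 1) - Polynomial.X,
    Polynomial.monic_X_pow_sub (by rw [Polynomial.degree_X]; exact_mod_cast Nat.succ_lt_succ hm), ?_⟩
  simpa using h1

/-- Rotation moves the first factor to the end, and `x * y = 1` iff `y * x = 1`. -/
theorem list_prod_ofFn_rotate_eq_one_iff {G : Type*} [Group G] (a : Fin n → G) :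
    (List.ofFn (a ∘ finRotate n)).prod = 1 ↔ (List.ofFn a).prod = 1 := by
  cases n with
  | zero => simp
  | succ n =>
    have : a ∘ finRotate (n + 1) = Fin.snoc (α := fun _ => G) (Fin.tail a) (a 0) := by
      rw [Fin.snoc_eq_cons_rotate]
      funext i
      exact (congrFun (Fin.cons_self_tail a) _).symm
    rw [this, List.ofFn_succ', List.ofFn_succ]
    simp only [Fin.snoc_castSucc, Fin.snoc_last, List.concat_eq_append, List.prod_append,
      List.prod_cons, List.prod_nil, mul_one]
    rw [mul_eq_one_iff_eq_inv, mul_eq_one_iff_inv_eq, eq_comm]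
    rfl

theorem list_prod_ofFn_conj {G : Type*} [Group G] (x : G) (a : Fin n → G) :
    (List.ofFn fun k => x⁻¹ * a k * x).prod = x⁻¹ * (List.ofFn a).prod * x := by
  have := map_list_prod (MulAut.conj x⁻¹) (List.ofFn a)
  rw [List.map_ofFn] at this
  simpa [Function.comp_def] using this.symm

end CyclicShift

/-! ### Indicators as traces on tensor powers -/

namespace DrinfeldDouble

variable {G : Type u} [Group G] [Fintype G]

-- The unevaluated expansion: keeping the `n` factors separate lets the trace be read on the
-- `n`-fold tensor power.
open Classical in
theorem sweedlerPow_basisElt_eq_sum_list (n : ℕ) (g x : G) :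
    sweedlerPow (DrinfeldDouble G) n (basisElt g x) =
      ∑ a : Fin n → G with (List.ofFn a).prod = g,
        (List.ofFn fun k => basisElt (a k) x).prod := by
  induction n generalizing g with
  | zero =>
    by_cases hg : g = 1
    · simp [sweedlerPow, counit_basisElt, hg]
    · simp [sweedlerPow, counit_basisElt, hg, Ne.symm hg]
  | succ n ih =>
    simp only [sweedlerPow_succ_basisElt, ih, Finset.sum_mul, Finset.sum_filter, ite_mul, zero_mul]
    rw [Finset.sum_comm, ← (Fin.snocEquiv (n := n) (fun _ => G)).sum_comp, Fintype.sum_prod_type_right]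
    refine Finset.sum_congr rfl fun a _ => ?_
    rw [Finset.sum_ite_eq, if_pos (Finset.mem_univ _),
      Finset.sum_eq_single ((List.ofFn a).prod⁻¹ * g)]
    · simp [List.ofFn_succ', Fin.snocEquiv, -List.ofFn_succ]
    · intro b _ hb
      rw [if_neg]
      contrapose hb
      simp only [List.ofFn_succ', Fin.snocEquiv, Equiv.coe_fn_mk, Fin.snoc_castSucc, Fin.snoc_last,
        List.concat_eq_append, List.prod_append, List.prod_singleton] at hb
      rw [← hb, inv_mul_cancel_left]
    · simp

section Operator

variable {I : Type*} [Fintype I] [DecidableEq I] (ρ : DrinfeldDouble G →ₐ[ℂ] Matrix I I ℂ) (n : ℕ)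

open Classical in
/-- The action on the degree-one part of an `n`-fold tensor power of the group element `x`. -/
def tensorAction (x : G) : Matrix (Fin n → I) (Fin n → I) ℂ :=
  ∑ a : Fin n → G with (List.ofFn a).prod = 1, tensorMatrix fun k => ρ (basisElt (a k) x)

theorem tensorAction_mul (x y : G) :
    tensorAction ρ n x * tensorAction ρ n y = tensorAction ρ n (x * y) := by
  classical
  simp only [tensorAction, Finset.sum_mul, Finset.mul_sum, tensorMatrix_mul, ← map_mul,
    basisElt_mul_basisElt]
  rw [Finset.sum_comm]
  refine Finset.sum_congr rfl fun a ha => ?_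
  -- Only the conjugated tuple gives a nonzero product in every tensor factor, and its total product
  -- is still `1`.
  rw [Finset.sum_eq_single fun k => x⁻¹ * a k * x]
  · congr 1
    funext k
    rw [if_pos (by group)]
  · intro b _ hb
    obtain ⟨k, hk⟩ := Function.ne_iff.1 hb
    refine tensorMatrix_eq_zero (k := k) ?_
    rw [if_neg, map_zero]
    intro h
    exact hk (by rw [h]; group)
  · intro h
    refine absurd (Finset.mem_filter.2 ⟨Finset.mem_univ _, ?_⟩) h
    rw [list_prod_ofFn_conj, (Finset.mem_filter.1 ha).2, mul_one, inv_mul_cancel]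

/-- The shift permutes the tuples of product `1`; for another total product, rotation would only
preserve it up to conjugacy. -/
theorem tensorAction_mul_cyclicShift (x : G) :
    Commute (tensorAction ρ n x) (cyclicShift I n) := by
  classical
  rw [Commute, SemiconjBy, tensorAction, Finset.sum_mul, Finset.mul_sum, Finset.sum_filter,
    Finset.sum_filter,
    ← ((finRotate n).symm.arrowCongr (Equiv.refl G)).sum_comp]
  refine Finset.sum_congr rfl fun a _ => ?_
  have : (finRotate n).symm.arrowCongr (Equiv.refl G) a = a ∘ finRotate n := rfl
  rw [this]
  refine if_congr (list_prod_ofFn_rotate_eq_one_iff a) ?_ rfl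
  exact tensorMatrix_mul_cyclicShift fun k => ρ (basisElt (a k) x)

/-- The action of the normalized integral on an `n`-fold tensor power. -/
def tensorIntegral : Matrix (Fin n → I) (Fin n → I) ℂ :=
  (Fintype.card G : ℂ)⁻¹ • ∑ x, tensorAction ρ n x

theorem isIdempotentElem_tensorIntegral : IsIdempotentElem (tensorIntegral ρ n) := by
  have hne : (Fintype.card G : ℂ) ≠ 0 := by exact_mod_cast Fintype.card_ne_zero
  have hsq : (∑ x, tensorAction ρ n x) * (∑ x, tensorAction ρ n x) =
      (Fintype.card G : ℂ) • ∑ x, tensorAction ρ n x := by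
    simp only [Finset.sum_mul, Finset.mul_sum, tensorAction_mul]
    have : ∀ y : G, ∑ x, tensorAction ρ n (x * y) = ∑ x, tensorAction ρ n x :=
      fun y => Equiv.sum_comp (Equiv.mulRight y) (fun x => tensorAction ρ n x)
    simp only [this, Finset.sum_const, Finset.card_univ, Nat.cast_smul_eq_nsmul]
  rw [IsIdempotentElem, tensorIntegral, smul_mul_smul_comm, hsq, smul_smul, mul_assoc,
    inv_mul_cancel₀ hne, mul_one]

theorem trace_tensorIntegral_mul_cyclicShift (hn : 0 < n) :
    (tensorIntegral ρ n * cyclicShift I n).trace =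
      (ρ (sweedlerPow (DrinfeldDouble G) n (integral G))).trace := by
  classical
  simp only [tensorIntegral, integral, map_smul, map_sum, sweedlerPow_basisElt_eq_sum_list,
    tensorAction, smul_mul_assoc, Finset.sum_mul, Matrix.trace_smul, Matrix.trace_sum,
    trace_tensorMatrix_mul_cyclicShift hn, map_list_prod, List.map_ofFn, Function.comp_def]

theorem isIntegral_trace_sweedlerPow_integral (hn : 0 < n) :
    IsIntegral ℤ (ρ (sweedlerPow (DrinfeldDouble G) n (integral G))).trace := by
  obtain ⟨m, hm, hC⟩ := exists_cyclicShift_pow_eq_one I n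
  rw [← trace_tensorIntegral_mul_cyclicShift ρ n hn]
  refine isIntegral_trace_of_pow_succ_eq hm ?_
  have hcomm : Commute (tensorIntegral ρ n) (cyclicShift I n) :=
    (Commute.sum_left _ _ _ fun x _ => tensorAction_mul_cyclicShift ρ n x).smul_left _
  -- `(E * C) ^ (m + 1) = E ^ (m + 1) * C ^ (m + 1) = E * C`, since `E` is idempotent and `C ^ m =
  -- 1`.
  rw [hcomm.mul_pow, (isIdempotentElem_tensorIntegral ρ n).pow_succ_eq, pow_succ, hC, one_mul]

end Operator

/-! ### Integrality of the indicators and conclusion -/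

instance : Module.Finite ℂ (DrinfeldDouble G) :=
  Module.Finite.equiv (M := G → G → ℂ)
    { coeffEquiv.symm with
      map_add' := fun _ _ => rfl
      map_smul' := fun _ _ => rfl }

variable (V : Type v) [AddCommGroup V] [Module ℂ V] [Module (DrinfeldDouble G) V]
  [IsScalarTower ℂ (DrinfeldDouble G) V]

theorem isIntegral_frobeniusSchurIndicator [Module.Finite ℂ V] {n : ℕ} (hn : 0 < n) :
    IsIntegral ℤ (frobeniusSchurIndicator (integral G) n V) := by
  classical
  let b := Module.finBasis ℂ V
  have h := isIntegral_trace_sweedlerPow_integral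
    ((LinearMap.toMatrixAlgEquiv b).toAlgHom.comp (Algebra.lsmul (A := DrinfeldDouble G) ℂ ℂ V)) n hn
  rw [frobeniusSchurIndicator, moduleCharacter, LinearMap.trace_eq_matrix_trace ℂ b]
  exact h

theorem frobeniusSchurIndicator_mem_int [Module.Finite ℂ V] {n : ℕ} (hn : 0 < n)
    (hG : ∀ u g g' : G, Subgroup.zpowers g = Subgroup.zpowers g' →
      commonRootCount n u g = commonRootCount n u g') :
    ∃ k : ℤ, frobeniusSchurIndicator (integral G) n V = k := by
  have hne : (Fintype.card G : ℂ) ≠ 0 := by exact_mod_cast Fintype.card_ne_zero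
  obtain ⟨c, hc⟩ := card_mul_frobeniusSchurIndicator_mem V n hG
  have hq : frobeniusSchurIndicator (integral G) n V =
      algebraMap ℚ ℂ ((c : ℚ) / (Fintype.card G : ℚ)) := by
    rw [map_div₀, map_natCast, map_intCast, eq_div_iff hne, mul_comm, ← hc]
    rfl
  have hint := isIntegral_frobeniusSchurIndicator (G := G) V hn
  rw [hq, isIntegral_algebraMap_iff (algebraMap ℚ ℂ).injective,
    IsIntegrallyClosed.isIntegral_iff] at hint
  obtain ⟨k, hk⟩ := hint
  exact ⟨k, by rw [hq, ← hk]; simp⟩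

theorem isFSZ_of_commonRootCount_eq
    (hG : ∀ n : ℕ, 0 < n → ∀ u g g' : G, Subgroup.zpowers g = Subgroup.zpowers g' →
      commonRootCount n u g = commonRootCount n u g') : IsFSZ.{u, v} G := by
  intro n hn V _ _ _ _ _
  -- A simple module is cyclic over `D(G)`, which is finite-dimensional.
  have : Module.Finite ℂ V := Module.Finite.trans (DrinfeldDouble G) V
  exact frobeniusSchurIndicator_mem_int V hn (hG n hn)

end DrinfeldDouble

end

theorem mainTheorem10 (G : Type u) [Group G] [Fintype G] :
    (IsRegularCNGroup G → IsFSZ.{u, v} G) ∧ (IsRegularNilpotent G → IsFSZ.{u, v} G) :=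
  ⟨fun h => DrinfeldDouble.isFSZ_of_commonRootCount_eq fun _ hn u _ _ hg =>
    h.commonRootCount_eq hn u hg,
  fun h => DrinfeldDouble.isFSZ_of_commonRootCount_eq fun _ hn u _ _ hg =>
    (h.powEqIff hn).commonRootCount_eq u hg⟩
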